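/- Let $n\ge 0$ and $c\ge 0$ be integers, and let $\mathcal V_c$ be the variety of all groups $H$ that have an abelian normal subgroup $N$ such that $H/N$ is nilpotent of class at most $c$. Let $G$ be a free abelian-by-nilpotent group of rank $n$ with free basis $x_1,\dots,x_n$, that is, a relatively free group of $\mathcal V_c$: $G$ belongs to $\mathcal V_c$, it is generated by $x_1,\dots,x_n$, and for every group $H$ in $\mathcal V_c$ and all $y_1,\dots,y_n\in H$ there is a homomorphism $G\to H$ with $x_i\mapsto y_i$ for all $i$. Assume that $G$ is not abelian. Call an element of $G$ a palindrome if it is represented by a reduced word in the alphabet $\{x_1^{\pm1},\dots,x_n^{\pm1}\}$ that reads the same from left to right and from right to left. Let the palindromic length $l_{\mathcal P}(g)$ of $g\in G$ be the minimal $k$ such that $g$ is a product of $k$ palindromes, and let ${\rm pw}(G)=\sup_{g\in G} l_{\mathcal P}(g)$ be the palindromic width of $G$ with respect to the basis $x_1,\dots,x_n$. Then every element of $G$ is a product of at most $5n$ palindromes, and so ${\rm pw}(G)\le 5n$. -/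

import Mathlib

/-- `g` is a palindrome of `G` in the alphabet `A^{±1}`: it is represented by a reduced word over
`A^{±1}` that reads the same in both directions. A letter is a pair `(a, ε)` with `a ∈ A`; it
stands for `a` if `ε = true` and for `a⁻¹` if `ε = false`. -/
def IsPalindromeIn {G : Type*} [Group G] (A : Set G) (g : G) : Prop :=
  ∃ w : List (A × Bool), FreeGroup.IsReduced w ∧ w.reverse = w ∧
    FreeGroup.lift (fun a : A => (a : G)) (FreeGroup.mk w) = g

/-- The palindromic length of `g` with respect to `A`: the minimal `k` such that `g` is a product
of `k` palindromes (and `⊤` if there is no such `k`). -/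
noncomputable def palindromicLength {G : Type*} [Group G] (A : Set G) (g : G) : ℕ∞ :=
  sInf {k : ℕ∞ | ∃ l : List G, (∀ p ∈ l, IsPalindromeIn A p) ∧ l.prod = g ∧
    k = (l.length : ℕ∞)}

/-- The palindromic width `pw(G)` of `G` with respect to `A`. -/
noncomputable def palindromicWidth {G : Type*} [Group G] (A : Set G) : ℕ∞ :=
  ⨆ g : G, palindromicLength A g

/-- `G` is abelian-by-(nilpotent of class at most `c`): it has an abelian normal subgroup `N` such
that `G ⧸ N` is nilpotent of class at most `c`. -/
def IsAbelianByNilpotent (c : ℕ) (G : Type*) [Group G] : Prop :=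
  ∃ (N : Subgroup G) (_ : N.Normal), (∀ a ∈ N, ∀ b ∈ N, a * b = b * a) ∧
    Group.IsNilpotent (G ⧸ N) ∧ Group.nilpotencyClass (G ⧸ N) ≤ c

/-- `G` is a free abelian-by-(nilpotent of class at most `c`) group with free basis
`x 0, …, x (n - 1)`, that is, a relatively free group of rank `n` in the variety of all
abelian-by-(nilpotent of class at most `c`) groups: `G` lies in this variety, the basis generates
`G`, and every map of the basis to a group of the variety extends to a homomorphism (which is then
unique). -/
structure IsFreeAbelianByNilpotentBasis.{u} (c : ℕ) {G : Type u} [Group G] {n : ℕ}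
    (x : Fin n → G) : Prop where
  isAbelianByNilpotent : IsAbelianByNilpotent c G
  closure_range : Subgroup.closure (Set.range x) = ⊤
  exists_hom : ∀ (H : Type u) [Group H], IsAbelianByNilpotent c H → ∀ y : Fin n → H,
    ∃ f : G →* H, ∀ i, f (x i) = y i

/-! Freeness gives an endomorphism `φ` inverting each generator. Since `(φ h)⁻¹` is `h` read
backwards, `h * p * (φ h)⁻¹` is a palindrome whenever `p` is (`IsPalindromeIn.conj`). Let `N` be
`lowerCentralSeries c`, an abelian subgroup. Modulo `⁅N, G⁆` the group is nilpotent, and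
`exists_eq_prod_zpow_mul_conj` applies. Each of its `n` factors costs three palindromes: `x i ^ α
i`, `h i * x i * (φ (h i))⁻¹` and `φ (h i) * (h i)⁻¹`. The error lies in `⁅N, G⁆`; by
`exists_eq_prod_inv_mul_conj_mul` it costs `2 * n + 1` palindromes, and a shift by `x 0` saves one.
The total is `3 * n + 2 * n`. -/

open scoped commutatorElement

/-! ### Ordered products with commuting factors. -/

section ListProducts

variable {ι Q : Type*} [Group Q]

theorem List.prod_map_mul_of_commute (L : List ι) (f g : ι → Q)
    (h : ∀ i j, Commute (g i) (f j)) :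
    (L.map fun i => f i * g i).prod = (L.map f).prod * (L.map g).prod := by
  induction L with
  | nil => simp
  | cons a L ih =>
    have hc : Commute (g a) (L.map f).prod := by
      apply Commute.list_prod_right
      simp only [List.mem_map, forall_exists_index, and_imp]
      rintro _ j _ rfl
      exact h a j
    simp only [List.map_cons, List.prod_cons, ih]
    rw [mul_assoc, mul_assoc, ← mul_assoc (g a), hc.eq, mul_assoc]

theorem List.prod_map_mulSingle [DecidableEq ι] (L : List ι) (hL : L.Nodup) (j : ι) (hj : j ∈ L)
    (c : Q) : (L.map (Pi.mulSingle (M := fun _ => Q) j c)).prod = c := by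
  induction L with
  | nil => simp at hj
  | cons a L ih =>
    rw [List.nodup_cons] at hL
    rw [List.map_cons, List.prod_cons]
    rcases eq_or_ne j a with rfl | hne
    · rw [Pi.mulSingle_eq_same, List.prod_eq_one, mul_one]
      simp only [List.mem_map, forall_exists_index, and_imp]
      rintro _ i hi rfl
      rw [Pi.mulSingle_eq_of_ne (ne_of_mem_of_not_mem hi hL.1)]
    · rw [Pi.mulSingle_eq_of_ne hne.symm, one_mul]
      exact ih hL.2 ((List.mem_cons.1 hj).resolve_left hne)

end ListProducts

/-! ### Commutators with generators, and factorization in nilpotent groups. -/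

section Commutators

variable {Q : Type*} [Group Q]

theorem commutatorElement_mul_left_of_commute (a b g : Q) (h : Commute a ⁅b, g⁆) :
    ⁅a * b, g⁆ = ⁅b, g⁆ * ⁅a, g⁆ := by
  have h' : a * ⁅b, g⁆ = ⁅b, g⁆ * a := h
  calc ⁅a * b, g⁆ = a * ⁅b, g⁆ * (g * a⁻¹ * g⁻¹) := by simp only [commutatorElement_def]; group
    _ = _ := by rw [h']; simp only [commutatorElement_def]; group

/-- If `A` is normal and centralizes `⁅A, Q⁆`, then every element of `⁅A, Q⁆` is a product of
commutators `⁅a i, x i⁆` with one factor for each generator `x i` of `Q`. -/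
theorem exists_eq_prod_commutator_of_mem {n : ℕ} (x : Fin n → Q)
    (hx : Subgroup.closure (Set.range x) = ⊤) (A : Subgroup Q) [hA : A.Normal]
    (hcomm : ∀ a ∈ A, ∀ d ∈ ⁅A, (⊤ : Subgroup Q)⁆, Commute a d) (z : Q)
    (hz : z ∈ ⁅A, (⊤ : Subgroup Q)⁆) :
    ∃ a : Fin n → Q, (∀ i, a i ∈ A) ∧ z = ((List.finRange n).map fun i => ⁅a i, x i⁆).prod := by
  have hle : ⁅A, (⊤ : Subgroup Q)⁆ ≤ A := Subgroup.commutator_le_left A ⊤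
  have hmem : ∀ a ∈ A, ∀ g, ⁅a, g⁆ ∈ ⁅A, (⊤ : Subgroup Q)⁆ := fun a ha g =>
    Subgroup.commutator_mem_commutator ha (Subgroup.mem_top g)
  set S : Subgroup Q := Subgroup.closure {d | ∃ a ∈ A, ∃ i, ⁅a, x i⁆ = d} with hS
  -- Commutator identities reduce `g` to generators at the price of changing `a` within the normal
  -- subgroup `A`; hence `a` stays universally quantified.
  have hgen : ∀ g : Q, ∀ a ∈ A, ⁅a, g⁆ ∈ S := by
    intro g
    have hg : g ∈ Subgroup.closure (Set.range x) := hx ▸ Subgroup.mem_top g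
    induction hg using Subgroup.closure_induction with
    | mem y hy =>
      obtain ⟨i, rfl⟩ := hy
      exact fun a ha => Subgroup.subset_closure ⟨a, ha, i, rfl⟩
    | one => intro a _; simp [S.one_mem]
    | mul g h _ _ ihg ihh =>
      intro a ha
      have e : ⁅a, g * h⁆ = ⁅a, g⁆ * (⁅⁅a, h⁆, g⁆)⁻¹ * ⁅a, h⁆ := by
        simp only [commutatorElement_def]; group
      rw [e]
      exact S.mul_mem (S.mul_mem (ihg a ha) (S.inv_mem (ihg _ (hle (hmem a ha h))))) (ihh a ha)
    | inv g _ ihg =>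
      intro a ha
      have e : ⁅a, g⁻¹⁆ = (⁅g⁻¹ * a * g, g⁆)⁻¹ := by
        simp only [commutatorElement_def]; group
      rw [e]
      exact S.inv_mem (ihg _ (by simpa using hA.conj_mem a ha g⁻¹))
  have hzS : z ∈ S := (Subgroup.commutator_le.2 fun a ha g _ => hgen g a ha) hz
  -- On `A` each `a ↦ ⁅a, x i⁆` is a homomorphism, and the values commute, so factors with the same
  -- `i` merge.
  have hmul : ∀ a b : Fin n → Q, (∀ i, a i ∈ A) → (∀ i, b i ∈ A) →
      ((List.finRange n).map fun i => ⁅a i * b i, x i⁆).prod =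
        ((List.finRange n).map fun i => ⁅a i, x i⁆).prod *
          ((List.finRange n).map fun i => ⁅b i, x i⁆).prod := by
    intro a b ha hb
    rw [← List.prod_map_mul_of_commute]
    · congr 2
      funext i
      rw [commutatorElement_mul_left_of_commute _ _ _ (hcomm _ (ha i) _ (hmem _ (hb i) _))]
      exact hcomm _ (hle (hmem _ (hb i) _)) _ (hmem _ (ha i) _)
    · exact fun i j => hcomm _ (hle (hmem _ (hb i) _)) _ (hmem _ (ha j) _)
  clear hz
  induction hzS using Subgroup.closure_induction with
  | mem y hy =>
    obtain ⟨a, ha, j, rfl⟩ := hy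
    refine ⟨Pi.mulSingle j a, fun i => ?_, ?_⟩
    · rcases eq_or_ne i j with rfl | h
      · rwa [Pi.mulSingle_eq_same]
      · rw [Pi.mulSingle_eq_of_ne h]; exact A.one_mem
    · rw [← List.prod_map_mulSingle (List.finRange n) (List.nodup_finRange n) j
        (List.mem_finRange j) ⁅a, x j⁆]
      congr 2
      funext i
      rcases eq_or_ne i j with rfl | h
      · simp
      · simp [Pi.mulSingle_eq_of_ne h]
  | one => exact ⟨1, fun _ => A.one_mem, by simp⟩
  | mul y z _ _ ihy ihz =>
    obtain ⟨a, ha, rfl⟩ := ihy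
    obtain ⟨b, hb, rfl⟩ := ihz
    exact ⟨fun i => a i * b i, fun i => A.mul_mem (ha i) (hb i), (hmul a b ha hb).symm⟩
  | inv y _ ihy =>
    obtain ⟨a, ha, rfl⟩ := ihy
    refine ⟨fun i => (a i)⁻¹, fun i => A.inv_mem (ha i), ?_⟩
    rw [inv_eq_iff_mul_eq_one, ← hmul a _ ha fun i => A.inv_mem (ha i)]
    simp

/-- A factorization over a quotient `Q ⧸ Z` lifts to `Q` modulo `Z`. -/
theorem exists_prod_zpow_mul_conj_inv_mul_mem {n : ℕ} (x : Fin n → Q) (Z : Subgroup Q) [Z.Normal]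
    (g : Q) (H : ∃ (α : Fin n → ℤ) (h : Fin n → Q ⧸ Z), QuotientGroup.mk' Z g =
      ((List.finRange n).map fun i => QuotientGroup.mk' Z (x i) ^ α i *
        (h i * QuotientGroup.mk' Z (x i) * (h i)⁻¹)).prod) :
    ∃ (α : Fin n → ℤ) (h : Fin n → Q),
      ((List.finRange n).map fun i => x i ^ α i * (h i * x i * (h i)⁻¹)).prod⁻¹ * g ∈ Z := by
  obtain ⟨α, h', hg⟩ := H
  choose h hh using fun i => QuotientGroup.mk'_surjective Z (h' i)
  refine ⟨α, h, QuotientGroup.eq.1 (Eq.symm ?_)⟩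
  change QuotientGroup.mk' Z g = QuotientGroup.mk' Z _
  rw [hg, map_list_prod, List.map_map]
  congr 2
  funext i
  simp only [Function.comp, map_mul, map_zpow, map_inv, hh]

theorem closure_range_mk'_eq_top {n : ℕ} (x : Fin n → Q)
    (hx : Subgroup.closure (Set.range x) = ⊤) (Z : Subgroup Q) [Z.Normal] :
    Subgroup.closure (Set.range fun i => QuotientGroup.mk' Z (x i)) = ⊤ := by
  rw [Set.range_comp' (QuotientGroup.mk' Z) x, ← MonoidHom.map_closure, hx,
    Subgroup.map_top_of_surjective _ (QuotientGroup.mk'_surjective Z)]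

theorem lowerCentralSeries_quotient_eq_bot_iff (Z : Subgroup Q) [Z.Normal] (k : ℕ) :
    (⊤ : Subgroup (Q ⧸ Z)).lowerCentralSeries k = ⊥ ↔
      (⊤ : Subgroup Q).lowerCentralSeries k ≤ Z := by
  rw [← Subgroup.map_top_of_surjective _ (QuotientGroup.mk'_surjective Z),
    ← Subgroup.map_lowerCentralSeries, Subgroup.map_eq_bot_iff, QuotientGroup.ker_mk']

/-- In a nilpotent group generated by `x 0, …, x (n - 1)`, every element is a product over `i` of
factors `x i ^ α i * (h i * x i * (h i)⁻¹)`. -/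
theorem exists_eq_prod_zpow_mul_conj {n : ℕ} (k : ℕ) {Q : Type*} [Group Q] (x : Fin n → Q)
    (hx : Subgroup.closure (Set.range x) = ⊤)
    (hk : (⊤ : Subgroup Q).lowerCentralSeries (k + 1) = ⊥) (g : Q) :
    ∃ (α : Fin n → ℤ) (h : Fin n → Q),
      g = ((List.finRange n).map fun i => x i ^ α i * (h i * x i * (h i)⁻¹)).prod := by
  induction k generalizing Q with
  | zero =>
    have hab : ∀ a b : Q, Commute a b := fun a b => by
      have : ⁅a, b⁆ ∈ (⊤ : Subgroup Q).lowerCentralSeries (0 + 1) :=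
        Subgroup.commutator_mem_commutator (Subgroup.mem_top a) (Subgroup.mem_top b)
      rw [hk, Subgroup.mem_bot, commutatorElement_eq_one_iff_commute] at this
      exact this
    suffices H : ∃ α : Fin n → ℤ, g = ((List.finRange n).map fun i => x i ^ α i).prod by
      obtain ⟨α, rfl⟩ := H
      -- The exponent drops by one to make up for the compulsory conjugate of `x i`.
      refine ⟨fun i => α i - 1, 1, ?_⟩
      congr 2
      funext i
      simp [zpow_sub]
    have hg : g ∈ Subgroup.closure (Set.range x) := hx ▸ Subgroup.mem_top g
    have hmul : ∀ α β : Fin n → ℤ, ((List.finRange n).map fun i => x i ^ (α i + β i)).prod =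
        ((List.finRange n).map fun i => x i ^ α i).prod *
          ((List.finRange n).map fun i => x i ^ β i).prod := fun α β => by
      rw [← List.prod_map_mul_of_commute _ _ _ fun _ _ => hab _ _]
      simp only [zpow_add]
    induction hg using Subgroup.closure_induction with
    | mem y hy =>
      obtain ⟨j, rfl⟩ := hy
      refine ⟨Pi.single j 1, ?_⟩
      rw [← List.prod_map_mulSingle (List.finRange n) (List.nodup_finRange n) j
        (List.mem_finRange j) (x j)]
      congr 2
      funext i
      rcases eq_or_ne i j with rfl | h
      · simp
      · simp [Pi.mulSingle_eq_of_ne h, Pi.single_eq_of_ne h]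
    | one => exact ⟨0, by simp⟩
    | mul y z _ _ ihy ihz =>
      obtain ⟨α, rfl⟩ := ihy
      obtain ⟨β, rfl⟩ := ihz
      exact ⟨fun i => α i + β i, (hmul α β).symm⟩
    | inv y _ ihy =>
      obtain ⟨α, rfl⟩ := ihy
      refine ⟨fun i => -α i, ?_⟩
      rw [inv_eq_iff_mul_eq_one, ← hmul]
      simp
  | succ k ih =>
    set Z := (⊤ : Subgroup Q).lowerCentralSeries (k + 1) with hZ
    have hcen : ∀ z ∈ Z, ∀ q : Q, Commute z q := fun z hz q => by
      have : ⁅z, q⁆ ∈ (⊤ : Subgroup Q).lowerCentralSeries (k + 1 + 1) :=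
        Subgroup.commutator_mem_commutator hz (Subgroup.mem_top q)
      rw [hk, Subgroup.mem_bot, commutatorElement_eq_one_iff_commute] at this
      exact this
    obtain ⟨α, h, hz⟩ := exists_prod_zpow_mul_conj_inv_mul_mem x Z g
      (ih _ (closure_range_mk'_eq_top x hx Z)
        ((lowerCentralSeries_quotient_eq_bot_iff Z _).2 le_rfl) _)
    set p := ((List.finRange n).map fun i => x i ^ α i * (h i * x i * (h i)⁻¹)).prod with hp
    obtain ⟨a, ha, hza⟩ := exists_eq_prod_commutator_of_mem x hx
      ((⊤ : Subgroup Q).lowerCentralSeries k) (fun a _ d hd => (hcen d hd a).symm) _ hz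
    have hac : ∀ i q, ⁅a i, q⁆ ∈ Z := fun i q =>
      Subgroup.commutator_mem_commutator (ha i) (Subgroup.mem_top q)
    -- Replacing `h i` by `h i * a i` multiplies the `i`-th factor by the central element `⁅a i, x
    -- i⁆`.
    refine ⟨α, fun i => h i * a i, ?_⟩
    rw [← mul_inv_cancel_left p g, hza, hp, ← List.prod_map_mul_of_commute _ _ _
      fun i j => hcen _ (hac i _) _]
    congr 2
    funext i
    calc x i ^ α i * (h i * x i * (h i)⁻¹) * ⁅a i, x i⁆
        = x i ^ α i * (h i * (x i * ((h i)⁻¹ * ⁅a i, x i⁆))) := by group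
      _ = x i ^ α i * (h i * (⁅a i, x i⁆ * x i * (h i)⁻¹)) := by
          rw [← (hcen _ (hac i (x i)) (h i)⁻¹).eq, ← mul_assoc (x i),
            ← (hcen _ (hac i (x i)) (x i)).eq]
      _ = _ := by simp only [commutatorElement_def]; group

end Commutators

/-! ### Palindromes and the bound `5 * n`. -/

section Palindromes

variable {G : Type*} [Group G]

/-- Inversion reverses a word and flips its letters; flipping them back leaves the reversal. -/
theorem FreeGroup.mk_reverse {α : Type*} (L : List (α × Bool)) :
    FreeGroup.mk L.reverse =
      (FreeGroup.lift (fun a : α => (FreeGroup.of a)⁻¹) (FreeGroup.mk L))⁻¹ := by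
  induction L with
  | nil => simp [← FreeGroup.one_eq_mk]
  | cons a L ih =>
    obtain ⟨a, b⟩ := a
    have e : FreeGroup.mk ((a, b) :: L) = FreeGroup.mk [(a, b)] * FreeGroup.mk L := by
      rw [FreeGroup.mul_mk, List.singleton_append]
    rw [List.reverse_cons, ← FreeGroup.mul_mk, ih, e, MonoidHom.map_mul, mul_inv_rev]
    congr 1
    cases b <;> simp [FreeGroup.of, FreeGroup.inv_mk, FreeGroup.invRev]

theorem FreeGroup.IsReduced.reverse {α : Type*} {L : List (α × Bool)} (h : FreeGroup.IsReduced L) :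
    FreeGroup.IsReduced L.reverse := by
  unfold FreeGroup.IsReduced at *
  rw [List.isChain_reverse]
  exact h.imp fun a b hab e => (hab e.symm).symm

/-- The hypothesis says that reversal fixes `w`; uniqueness of reduced words then makes `w.toWord`
itself palindromic. -/
theorem isPalindromeIn_lift (A : Set G) (w : FreeGroup A)
    (hw : (FreeGroup.lift (fun a : A => (FreeGroup.of a)⁻¹) w)⁻¹ = w) :
    IsPalindromeIn A (FreeGroup.lift (fun a : A => (a : G)) w) := by
  classical
  refine ⟨w.toWord, FreeGroup.isReduced_toWord, ?_, by rw [FreeGroup.mk_toWord]⟩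
  have h := FreeGroup.mk_reverse w.toWord
  rw [FreeGroup.mk_toWord, hw] at h
  rw [← (FreeGroup.isReduced_toWord (x := w)).reverse.reduce_eq, ← FreeGroup.toWord_mk, h]

variable {A : Set G} {φ : G →* G}

theorem IsPalindromeIn.conj (hA : Subgroup.closure A = ⊤) (hφ : ∀ a ∈ A, φ a = a⁻¹) {p : G}
    (hp : IsPalindromeIn A p) (h : G) : IsPalindromeIn A (h * p * (φ h)⁻¹) := by
  obtain ⟨w, _, hw, rfl⟩ := hp
  have hw' := FreeGroup.mk_reverse w
  rw [hw] at hw'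
  have hinv : ∀ v : FreeGroup A, FreeGroup.lift (fun a : A => (FreeGroup.of a)⁻¹)
      (FreeGroup.lift (fun a : A => (FreeGroup.of a)⁻¹) v) = v := fun v => by
    have : (FreeGroup.lift (fun a : A => (FreeGroup.of a)⁻¹)).comp
      (FreeGroup.lift (fun a : A => (FreeGroup.of a)⁻¹)) = MonoidHom.id _ := by
        ext a; simp
    exact DFunLike.congr_fun this v
  have hlift : ∀ v : FreeGroup A, FreeGroup.lift (fun a : A => (a : G))
      (FreeGroup.lift (fun a : A => (FreeGroup.of a)⁻¹) v) =
        φ (FreeGroup.lift (fun a : A => (a : G)) v) := fun v => by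
    have : (FreeGroup.lift (fun a : A => (a : G))).comp
      (FreeGroup.lift (fun a : A => (FreeGroup.of a)⁻¹)) =
        φ.comp (FreeGroup.lift (fun a : A => (a : G))) := by
        ext a; simp [hφ _ a.2]
    exact DFunLike.congr_fun this v
  obtain ⟨v, rfl⟩ : ∃ v, FreeGroup.lift (fun a : A => (a : G)) v = h := by
    have : h ∈ (FreeGroup.lift (fun a : A => (a : G))).range := by
      rw [FreeGroup.range_lift_eq_closure, Subtype.range_coe, hA]; trivial
    exact this
  have key := isPalindromeIn_lift A
    (v * FreeGroup.mk w * (FreeGroup.lift (fun a : A => (FreeGroup.of a)⁻¹) v)⁻¹)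
    (by simp only [map_mul, map_inv, hinv, mul_inv_rev, inv_inv, mul_assoc, ← hw'])
  simpa only [map_mul, map_inv, hlift] using key

theorem IsPalindromeIn.zpow {a : G} (ha : a ∈ A) (k : ℤ) : IsPalindromeIn A (a ^ k) := by
  have := isPalindromeIn_lift A (FreeGroup.of ⟨a, ha⟩ ^ k) (by simp)
  simpa using this

theorem isPalindromeIn_one : IsPalindromeIn A (1 : G) :=
  ⟨[], FreeGroup.IsReduced.nil, rfl, by simp [← FreeGroup.one_eq_mk]⟩

theorem exists_palindromes_mul {k l : ℕ} {g h : G}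
    (hg : ∃ L : List G, L.length ≤ k ∧ (∀ p ∈ L, IsPalindromeIn A p) ∧ L.prod = g)
    (hh : ∃ L : List G, L.length ≤ l ∧ (∀ p ∈ L, IsPalindromeIn A p) ∧ L.prod = h) :
    ∃ L : List G, L.length ≤ k + l ∧ (∀ p ∈ L, IsPalindromeIn A p) ∧ L.prod = g * h := by
  obtain ⟨L, hk, hL, rfl⟩ := hg
  obtain ⟨M, hl, hM, rfl⟩ := hh
  refine ⟨L ++ M, by rw [List.length_append]; lia, fun p hp => ?_, List.prod_append⟩
  exact (List.mem_append.1 hp).elim (hL p) (hM p)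

theorem exists_palindromes_prod {ι : Type*} {k : ℕ} {f : ι → G}
    (hf : ∀ i, ∃ L : List G, L.length ≤ k ∧ (∀ p ∈ L, IsPalindromeIn A p) ∧ L.prod = f i)
    (I : List ι) :
    ∃ L : List G, L.length ≤ k * I.length ∧ (∀ p ∈ L, IsPalindromeIn A p) ∧
      L.prod = (I.map f).prod := by
  induction I with
  | nil => exact ⟨[], by simp⟩
  | cons i I ih =>
    rw [List.map_cons, List.prod_cons, List.length_cons, mul_add_one, add_comm]
    exact exists_palindromes_mul (hf i) ih

theorem MonoidHom.map_mem_lowerCentralSeries_top (φ : G →* G) (k : ℕ) {a : G}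
    (ha : a ∈ (⊤ : Subgroup G).lowerCentralSeries k) :
    φ a ∈ (⊤ : Subgroup G).lowerCentralSeries k := by
  have h := Subgroup.mem_map_of_mem φ ha
  rw [Subgroup.map_lowerCentralSeries] at h
  exact Subgroup.lowerCentralSeries_mono k le_top h

/-- If `N` is an abelian normal subgroup invariant under `φ`, then every element of `⁅N, G⁆` is the
product of one palindrome and of one factor `(x i)⁻¹ * (h i * x i * (φ (h i))⁻¹)` for each generator
`x i`. -/
theorem exists_eq_prod_inv_mul_conj_mul {n : ℕ} (x : Fin n → G)
    (hx : Subgroup.closure (Set.range x) = ⊤) (N : Subgroup G) [hN : N.Normal]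
    (hab : ∀ a ∈ N, ∀ b ∈ N, a * b = b * a) (hφN : ∀ a ∈ N, φ a ∈ N) (z : G)
    (hz : z ∈ ⁅N, (⊤ : Subgroup G)⁆) :
    ∃ (h : Fin n → G) (v : G), z =
      ((List.finRange n).map fun i => (x i)⁻¹ * (h i * x i * (φ (h i))⁻¹)).prod *
        (v * 1 * (φ v)⁻¹) := by
  obtain ⟨a, ha, rfl⟩ := exists_eq_prod_commutator_of_mem x hx N
    (fun a ha d hd => hab a ha d (Subgroup.commutator_le_left N ⊤ hd)) z hz
  -- Here `⁅a i, x i⁆ = a i * w i`. Split it as `a i * φ (w i)`, the `i`-th factor, times `w i * (φ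
  -- (w i))⁻¹`; the latter merge over `i` into one palindrome because `N` is abelian.
  set w : Fin n → G := fun i => x i * (a i)⁻¹ * (x i)⁻¹ with hw
  have hwN : ∀ i, w i ∈ N := fun i => hN.conj_mem _ (N.inv_mem (ha i)) _
  have hxw : ∀ i, (x i)⁻¹ * (w i)⁻¹ * x i = a i := fun i => by rw [hw]; group
  refine ⟨fun i => (w i)⁻¹, ((List.finRange n).map w).prod, ?_⟩
  have hv : (φ ((List.finRange n).map w).prod)⁻¹ =
      ((List.finRange n).map fun i => (φ (w i))⁻¹).prod := by
    rw [inv_eq_iff_mul_eq_one, map_list_prod, List.map_map, ← List.prod_map_mul_of_commute]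
    · simp
    · exact fun i j => hab _ (N.inv_mem (hφN _ (hwN i))) _ (hφN _ (hwN j))
  rw [hv, mul_one, ← List.prod_map_mul_of_commute, ← List.prod_map_mul_of_commute]
  · congr 2
    funext i
    have hc := hab _ (hwN i) _ (N.inv_mem (hφN _ (hwN i)))
    have e : ⁅a i, x i⁆ = (x i)⁻¹ * (w i)⁻¹ * x i * w i := by
      rw [hxw]; simp only [hw, commutatorElement_def]; group
    rw [hc, e, map_inv, inv_inv]
    group
  · intro i j
    refine hab _ (N.mul_mem (hwN i) (N.inv_mem (hφN _ (hwN i)))) _ ?_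
    have : (x j)⁻¹ * ((w j)⁻¹ * x j * (φ (w j)⁻¹)⁻¹) = a j * φ (w j) := by
      rw [← hxw j]; simp [mul_assoc]
    rw [this]
    exact N.mul_mem (ha j) (hφN _ (hwN j))
  · exact fun i j => hab _ (N.inv_mem (hφN _ (hwN i))) _ (hwN j)

/-- If the `c`-th term of the lower central series of `G` is abelian and `x i ↦ (x i)⁻¹` extends to
an endomorphism, then every element of `G` is a product of `5 * n` palindromes. -/
theorem exists_palindromes_of_commute_lowerCentralSeries {n c : ℕ} (x : Fin n → G)
    (hx : Subgroup.closure (Set.range x) = ⊤) (hφ : ∀ i, φ (x i) = (x i)⁻¹)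
    (hab : ∀ a ∈ (⊤ : Subgroup G).lowerCentralSeries c,
      ∀ b ∈ (⊤ : Subgroup G).lowerCentralSeries c, a * b = b * a) (g : G) :
    ∃ L : List G, L.length ≤ 5 * n ∧ (∀ p ∈ L, IsPalindromeIn (Set.range x) p) ∧
      L.prod = g := by
  have hφ' : ∀ a ∈ Set.range x, φ a = a⁻¹ := by rintro _ ⟨i, rfl⟩; exact hφ i
  have hpow : ∀ i (k : ℤ), IsPalindromeIn (Set.range x) (x i ^ k) := fun i k =>
    IsPalindromeIn.zpow (Set.mem_range_self i) k
  have hconj : ∀ i h, IsPalindromeIn (Set.range x) (h * x i * (φ h)⁻¹) := fun i h => by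
    have := (hpow i 1).conj hx hφ' h
    rwa [zpow_one] at this
  have hone : ∀ h, IsPalindromeIn (Set.range x) (h * 1 * (φ h)⁻¹) :=
    isPalindromeIn_one.conj hx hφ'
  have hφφ : ∀ h, φ (φ h) = h := fun h => by
    have : φ.comp φ = MonoidHom.id G := MonoidHom.eq_of_eqOn_dense hx (by
      rintro _ ⟨i, rfl⟩; simp [hφ])
    exact DFunLike.congr_fun this h
  obtain _ | m := n
  · have hg : g ∈ Subgroup.closure (Set.range x) := hx ▸ Subgroup.mem_top g
    rw [Set.range_eq_empty, Subgroup.closure_empty, Subgroup.mem_bot] at hg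
    exact ⟨[], by simp [hg]⟩
  -- Factoring `g * (x 0)⁻¹` leaves a spare `x 0`. Moved to the left of the error, it cancels the
  -- leading `(x 0)⁻¹` there and saves one palindrome.
  obtain ⟨α, h, hz⟩ := exists_prod_zpow_mul_conj_inv_mul_mem x
    ((⊤ : Subgroup G).lowerCentralSeries (c + 1)) (g * (x 0)⁻¹)
    (exists_eq_prod_zpow_mul_conj c _ (closure_range_mk'_eq_top x hx _)
      ((lowerCentralSeries_quotient_eq_bot_iff _ _).2 le_rfl) _)
  set p := ((List.finRange (m + 1)).map fun i => x i ^ α i * (h i * x i * (h i)⁻¹)).prod with hp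
  obtain ⟨u, v, huv⟩ := exists_eq_prod_inv_mul_conj_mul (φ := φ) x hx
    ((⊤ : Subgroup G).lowerCentralSeries c) hab
    (fun a ha => φ.map_mem_lowerCentralSeries_top c ha) ((x 0)⁻¹ * (p⁻¹ * (g * (x 0)⁻¹)) * x 0)
    (by
      have := (inferInstance : ((⊤ : Subgroup G).lowerCentralSeries (c + 1)).Normal).conj_mem
        _ hz (x 0)⁻¹
      rwa [inv_inv] at this)
  rw [List.finRange_succ, List.map_cons, List.prod_cons, List.map_map] at huv
  have hg : g = p * (u 0 * x 0 * (φ (u 0))⁻¹ *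
      (((List.finRange m).map fun i : Fin m => (x i.succ)⁻¹ *
        (u i.succ * x i.succ * (φ (u i.succ))⁻¹)).prod * (v * 1 * (φ v)⁻¹))) := by
    have e : g = p * (x 0 * ((x 0)⁻¹ * (p⁻¹ * (g * (x 0)⁻¹)) * x 0)) := by group
    rw [e, huv]
    simp only [Function.comp_def, mul_assoc, mul_inv_cancel_left]
  have h1 := exists_palindromes_prod (A := Set.range x) (k := 3)
    (f := fun i => x i ^ α i * (h i * x i * (h i)⁻¹)) (fun i =>
      ⟨[x i ^ α i, h i * x i * (φ (h i))⁻¹, φ (h i) * 1 * (φ (φ (h i)))⁻¹], by simp,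
        by simp only [List.mem_cons, List.not_mem_nil, or_false, forall_eq_or_imp, forall_eq]
           exact ⟨hpow _ _, hconj _ _, hone _⟩, by simp [hφφ, mul_assoc]⟩) (List.finRange (m + 1))
  have h2 := exists_palindromes_prod (A := Set.range x) (k := 2)
    (f := fun i : Fin m => (x i.succ)⁻¹ * (u i.succ * x i.succ * (φ (u i.succ))⁻¹)) (fun i =>
      ⟨[x i.succ ^ (-1 : ℤ), u i.succ * x i.succ * (φ (u i.succ))⁻¹], by simp,
        by simp only [List.mem_cons, List.not_mem_nil, or_false, forall_eq_or_imp, forall_eq]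
           exact ⟨hpow _ _, hconj _ _⟩, by simp⟩) (List.finRange m)
  have single : ∀ q, IsPalindromeIn (Set.range x) q → ∃ L : List G, L.length ≤ 1 ∧
      (∀ p ∈ L, IsPalindromeIn (Set.range x) p) ∧ L.prod = q := fun q hq => ⟨[q], by simpa⟩
  obtain ⟨L, hlen, hL, hprod⟩ := exists_palindromes_mul h1 (exists_palindromes_mul
    (single _ (hconj 0 (u 0))) (exists_palindromes_mul h2 (single _ (hone v))))
  refine ⟨L, hlen.trans ?_, hL, hprod.trans hg.symm⟩
  -- The count is `3 * (m + 1) + (1 + (2 * m + 1)) = 5 * (m + 1)`.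
  simp only [List.length_finRange]
  lia

end Palindromes

/-! ### Application to free abelian-by-nilpotent groups. -/

theorem IsAbelianByNilpotent.commute_lowerCentralSeries {c : ℕ} {G : Type*} [Group G]
    (hG : IsAbelianByNilpotent c G) :
    ∀ a ∈ (⊤ : Subgroup G).lowerCentralSeries c,
      ∀ b ∈ (⊤ : Subgroup G).lowerCentralSeries c, a * b = b * a := by
  obtain ⟨N, _, hN, _, hc⟩ := hG
  have hle := (lowerCentralSeries_quotient_eq_bot_iff N c).1
    (Subgroup.lowerCentralSeries_eq_bot_iff_nilpotencyClass_le.2 hc)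
  exact fun a ha b hb => hN a (hle ha) b (hle hb)

theorem mainTheorem3 {G : Type*} [Group G] (n c : ℕ) (x : Fin n → G)
    (hx : IsFreeAbelianByNilpotentBasis c x) (hG : ¬ ∀ a b : G, a * b = b * a) :
    (∀ g : G, ∃ l : List G, l.length ≤ 5 * n ∧
      (∀ p ∈ l, IsPalindromeIn (Set.range x) p) ∧ l.prod = g) ∧
    palindromicWidth (Set.range x) ≤ ((5 * n : ℕ) : ℕ∞) := by
  have key : ∀ g : G, ∃ l : List G, l.length ≤ 5 * n ∧
      (∀ p ∈ l, IsPalindromeIn (Set.range x) p) ∧ l.prod = g := by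
    -- Relative freeness serves only to provide this endomorphism.
    obtain ⟨φ, hφ⟩ := hx.exists_hom G hx.isAbelianByNilpotent fun i => (x i)⁻¹
    exact exists_palindromes_of_commute_lowerCentralSeries x hx.closure_range hφ
      hx.isAbelianByNilpotent.commute_lowerCentralSeries
  refine ⟨key, iSup_le fun g => ?_⟩
  obtain ⟨l, hlen, hl, hprod⟩ := key g
  have hle : palindromicLength (Set.range x) g ≤ (l.length : ℕ∞) :=
    sInf_le ⟨l, hl, hprod, rfl⟩
  exact hle.trans (Nat.cast_le.2 hlen)
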